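/- Let $\mathcal H^A,\mathcal H^B$ be finite-dimensional complex Hilbert spaces and let $\rho^{AB}$ be a state (positive semidefinite, unit trace) on $\mathcal H^A\otimes\mathcal H^B$, with reduced states $\rho^A,\rho^B$. Write $S(X)=-\mathrm{Tr}\,\rho^X\log_2\rho^X$ for the von Neumann entropy, $I(A:B)=S(A)+S(B)-S(AB)$, and $$J(A|B)=\max_{\{E_i\}}\Big(S(A)-\sum_i p_i\,S(\rho_i^A)\Big),\qquad D(A|B)=I(A:B)-J(A|B),$$ where the maximum is over all (finite) POVMs $\{E_i\}$ on $B$, $p_i=\mathrm{Tr}\big((1\otimes E_i)\rho^{AB}\big)$, $\rho_i^A=\mathrm{Tr}_B\big((1\otimes E_i)\rho^{AB}\big)/p_i$, and outcomes with $p_i=0$ contribute $0$. The discord $D(B|A)$ is defined in the same way with the roles of $A$ and $B$ exchanged. Let $E_F(A:B)=\min\sum_i p_i\,S(\mathrm{Tr}_B|\psi_i\rangle\langle\psi_i|)$, the minimum being over all finite pure-state ensembles with $\rho^{AB}=\sum_i p_i|\psi_i\rangle\langle\psi_i|$. 1. If $S(B)-S(A)=S(AB)$, then $D(A|B)=S(A)$.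 2. $S(B)-S(A)=S(AB)$ holds if and only if the support of $\rho^B$ can be identified (unitarily) with a tensor product $\mathcal H^{B^L}\otimes\mathcal H^{B^R}$ such that $$\rho^{AB}=|\psi\rangle\langle\psi|^{AB^L}\otimes\rho^{B^R}\qquad(*)$$ for some unit vector $|\psi\rangle\in\mathcal H^A\otimes\mathcal H^{B^L}$ and some state $\rho^{B^R}$ on $\mathcal H^{B^R}$. 3. Whenever $\rho^{AB}$ has the form $(*)$ for some subspace of $\mathcal H^B$ (possibly all of $\mathcal H^B$) identified with a tensor product $\mathcal H^{B^L}\otimes\mathcal H^{B^R}$, then $S(B)-S(A)=S(AB)$, the maxima in $J(A|B)$ and $J(B|A)$ and the minimum in $E_F(A:B)$ are attained, and $$D(A|B)=D(B|A)=E_F(A:B)=S(A)=S(B^L),$$ where $S(B^L)$ is the entropy of the reduced state of $|\psi\rangle\langle\psi|$ on $B^L$. -/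

import Mathlib

open scoped Kronecker ComplexOrder

namespace QDiscord

variable {n A B : Type*} [Fintype n] [Fintype A] [Fintype B]
  [DecidableEq n] [DecidableEq A] [DecidableEq B]

/-- A quantum state (density matrix): positive semidefinite with unit trace. -/
def IsState (ρ : Matrix n n ℂ) : Prop :=
  ρ.PosSemidef ∧ ρ.trace = 1

/-- `ψ` is a unit vector. -/
def IsUnitVector (ψ : n → ℂ) : Prop :=
  ∑ i, ‖ψ i‖ ^ 2 = 1

/-- The rank-one operator `|ψ⟩⟨ψ|`. -/
def proj (ψ : n → ℂ) : Matrix n n ℂ :=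
  Matrix.vecMulVec ψ (star ψ)

open Classical in
/-- The von Neumann entropy `S(ρ) = -Tr ρ log₂ ρ = -∑ λ log₂ λ`, over the eigenvalues `λ` of the
Hermitian matrix `ρ` with multiplicity, where `0 log₂ 0 = 0`. (On matrices that are not Hermitian,
where it is never used, the value is `0`.) -/
noncomputable def entropy (ρ : Matrix n n ℂ) : ℝ :=
  if h : ρ.IsHermitian then -∑ i, h.eigenvalues i * Real.logb 2 (h.eigenvalues i) else 0

/-- The partial trace `Tr_B`: the reduced operator on `A`. -/
def traceB (M : Matrix (A × B) (A × B) ℂ) : Matrix A A ℂ :=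
  Matrix.of fun a a' => ∑ b, M (a, b) (a', b)

/-- The partial trace `Tr_A`: the reduced operator on `B`. -/
def traceA (M : Matrix (A × B) (A × B) ℂ) : Matrix B B ℂ :=
  Matrix.of fun b b' => ∑ a, M (a, b) (a, b')

/-- The same bipartite operator with the two subsystems exchanged. -/
def swap (M : Matrix (A × B) (A × B) ℂ) : Matrix (B × A) (B × A) ℂ :=
  M.submatrix Prod.swap Prod.swap

/-- The mutual information `I(A:B) = S(A) + S(B) - S(AB)`. -/
noncomputable def mutualInfo (ρ : Matrix (A × B) (A × B) ℂ) : ℝ :=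
  entropy (traceB ρ) + entropy (traceA ρ) - entropy ρ

/-- A POVM with `k` outcomes: positive semidefinite matrices that sum to the identity. -/
def IsPOVM {k : ℕ} (E : Fin k → Matrix B B ℂ) : Prop :=
  (∀ i, (E i).PosSemidef) ∧ ∑ i, E i = 1

/-- The unnormalised post-measurement operator `Tr_B (E^B ρ^{AB})` on `A`. -/
noncomputable def postMeas (ρ : Matrix (A × B) (A × B) ℂ) (E : Matrix B B ℂ) : Matrix A A ℂ :=
  traceB (((1 : Matrix A A ℂ) ⊗ₖ E) * ρ)

/-- The probability `p = Tr (E^B ρ^{AB})` of an outcome. -/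
noncomputable def prob (ρ : Matrix (A × B) (A × B) ℂ) (E : Matrix B B ℂ) : ℝ :=
  (((1 : Matrix A A ℂ) ⊗ₖ E) * ρ).trace.re

/-- The conditional entropy `∑ i, p i * S(A|E i)`, where `S(A|E i)` is the entropy of the normalised
post-measurement state. Outcomes of probability `0` contribute `0`. -/
noncomputable def condEntropy (ρ : Matrix (A × B) (A × B) ℂ) {k : ℕ}
    (E : Fin k → Matrix B B ℂ) : ℝ :=
  ∑ i, prob ρ (E i) * entropy (((prob ρ (E i))⁻¹ : ℂ) • postMeas ρ (E i))

/-- The numbers `S(A) - ∑ i, p i * S(A|E i)`, for all POVMs on `B`. -/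
def measGains (ρ : Matrix (A × B) (A × B) ℂ) : Set ℝ :=
  {x | ∃ (k : ℕ) (E : Fin k → Matrix B B ℂ), IsPOVM E ∧
    x = entropy (traceB ρ) - condEntropy ρ E}

/-- The classical correlation `J(A|B)`, with measurements on the second subsystem. -/
noncomputable def classicalCorr (ρ : Matrix (A × B) (A × B) ℂ) : ℝ :=
  sSup (measGains ρ)

/-- The quantum discord `D(A|B) = I(A:B) - J(A|B)`, with measurements on the second subsystem.
The discord `D(B|A)` is `discord (swap ρ)`. -/
noncomputable def discord (ρ : Matrix (A × B) (A × B) ℂ) : ℝ :=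
  mutualInfo ρ - classicalCorr ρ

/-- `{p i, ψ i}` is an ensemble of pure states that realises `ρ`. -/
def IsPureEnsemble {k : ℕ} (ρ : Matrix n n ℂ) (p : Fin k → ℝ) (ψ : Fin k → n → ℂ) : Prop :=
  (∀ i, 0 ≤ p i) ∧ ∑ i, p i = 1 ∧ (∀ i, IsUnitVector (ψ i)) ∧ ρ = ∑ i, (p i : ℂ) • proj (ψ i)

/-- The average entanglements `∑ i, p i * S(Tr_B |ψ i⟩⟨ψ i|)` of the pure ensembles of `ρ`. -/
def avgEntanglements (ρ : Matrix (A × B) (A × B) ℂ) : Set ℝ :=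
  {x | ∃ (k : ℕ) (p : Fin k → ℝ) (ψ : Fin k → A × B → ℂ), IsPureEnsemble ρ p ψ ∧
    x = ∑ i, p i * entropy (traceB (proj (ψ i)))}

/-- The entanglement of formation `E_F(A:B)`. -/
noncomputable def entFormation (ρ : Matrix (A × B) (A × B) ℂ) : ℝ :=
  sInf (avgEntanglements ρ)

/-- `ρ^{AB} = |ψ⟩⟨ψ|^{A B^L} ⊗ σ^{B^R}`, where `B^L ⊗ B^R` is identified with a subspace of `B` by
the isometry `V`, `ψ` is a unit vector of `A ⊗ B^L`, and `σ` is a state of `B^R`. -/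
def HasForm {l r : ℕ} (ρ : Matrix (A × B) (A × B) ℂ) (V : Matrix B (Fin l × Fin r) ℂ)
    (ψ : A × Fin l → ℂ) (σ : Matrix (Fin r) (Fin r) ℂ) : Prop :=
  V.conjTranspose * V = 1 ∧ IsUnitVector ψ ∧ IsState σ ∧
    ρ = ((1 : Matrix A A ℂ) ⊗ₖ V) *
      (proj ψ ⊗ₖ σ).submatrix (Equiv.prodAssoc A (Fin l) (Fin r)).symm
        (Equiv.prodAssoc A (Fin l) (Fin r)).symm *
      ((1 : Matrix A A ℂ) ⊗ₖ V).conjTranspose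

end QDiscord

namespace QDiscord

open Matrix

set_option linter.unusedSectionVars false

open Matrix

/-! ### Entropy through the characteristic polynomial. -/

section Entropy

variable {m n : Type*} [Fintype m] [Fintype n] [DecidableEq m] [DecidableEq n]

/-! Everything rests on the structure of the states with S(B) - S(A) = S(AB). Purify ρ by a system R
whose dimension is the rank of ρ. Then S(AR) = S(B) and S(R) = S(AB), so the condition reads S(AR) =
S(A) + S(R). This is equality in subadditivity, and the equality case of Klein's inequality forces
the state of AR to be a product (`eq_kronecker_of_entropy_eq`). A product state is purified by a
product: ρ^A by a vector on A ⊗ B^L, and the state of R by one on B^R ⊗ R. Two purifications differ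
by an isometry of the purifying systems, here from B^L ⊗ B^R into B (`exists_hasForm`).

Conversely, the form (*) gives S(AB) = S(σ) and S(B) = S(A) + S(σ), hence I(A:B) = 2 S(A). Measuring
B^L in a basis leaves A pure, so J(A|B) reaches its upper bound S(A) (`HasForm.isGreatest`).
Measuring A leaves σ untouched, so the conditional entropy of B is at least S(σ), with equality for
a basis measurement, and J(B|A) = S(A) (`HasForm.isGreatest_swap`). The vectors of positive weight
in a pure ensemble lie in the range of ρ, hence are all of the form ψ ⊗ χ and have A-marginal ρ^A;
thus every ensemble has average entanglement S(A) (`HasForm.avgEntanglements_eq`). -/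

/-- The function `x ↦ -x log₂ x`. -/
noncomputable def eta (x : ℝ) : ℝ := -(x * Real.logb 2 x)

lemma eta_zero : eta 0 = 0 := by simp [eta]

lemma eta_one : eta 1 = 0 := by simp [eta]

lemma eta_nonneg {x : ℝ} (h0 : 0 ≤ x) (h1 : x ≤ 1) : 0 ≤ eta x := by
  have : Real.logb 2 x ≤ 0 := Real.logb_nonpos (by norm_num) h0 h1
  unfold eta
  nlinarith

lemma eta_mul (x y : ℝ) : eta (x * y) = y * eta x + x * eta y := by
  by_cases hx : x = 0
  · simp [hx, eta]
  by_cases hy : y = 0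
  · simp [hy, eta]
  unfold eta
  rw [Real.logb_mul hx hy]
  ring

/-- The sum of `-x log₂ x` over the roots of the characteristic polynomial. -/
noncomputable def charEntropy (M : Matrix n n ℂ) : ℝ :=
  (M.charpoly.roots.map fun z => eta z.re).sum

lemma entropy_eq_charEntropy {M : Matrix n n ℂ} (h : M.IsHermitian) :
    entropy M = charEntropy M := by
  rw [entropy, dif_pos h, charEntropy, h.roots_charpoly_eq_eigenvalues, Multiset.map_map,
    ← Finset.sum_neg_distrib]
  rfl

/-- The two characteristic polynomials agree up to powers of X, and the additional roots 0
contribute `eta 0 = 0`. Allowing rectangular factors covers isometries, Schmidt symmetry and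
purifications at once. -/
lemma charEntropy_mul_comm (M : Matrix m n ℂ) (N : Matrix n m ℂ) :
    charEntropy (M * N) = charEntropy (N * M) := by
  have h := congrArg Polynomial.roots (charpoly_mul_comm' M N)
  rw [Polynomial.roots_mul (mul_ne_zero (pow_ne_zero _ Polynomial.X_ne_zero)
      (charpoly_monic _).ne_zero), Polynomial.roots_mul (mul_ne_zero
      (pow_ne_zero _ Polynomial.X_ne_zero) (charpoly_monic _).ne_zero),
    Polynomial.roots_pow, Polynomial.roots_pow, Polynomial.roots_X] at h
  have h' := congrArg (fun s : Multiset ℂ => (s.map fun z => eta z.re).sum) h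
  simpa [charEntropy, Multiset.map_nsmul, Multiset.sum_nsmul, eta_zero] using h'

lemma entropy_mul_comm {M : Matrix m n ℂ} {N : Matrix n m ℂ} (h₁ : (M * N).IsHermitian)
    (h₂ : (N * M).IsHermitian) : entropy (M * N) = entropy (N * M) := by
  rw [entropy_eq_charEntropy h₁, entropy_eq_charEntropy h₂, charEntropy_mul_comm]

lemma entropy_mul_conjTranspose (M : Matrix m n ℂ) : entropy (M * Mᴴ) = entropy (Mᴴ * M) :=
  entropy_mul_comm (isHermitian_mul_conjTranspose_self M) (isHermitian_conjTranspose_mul_self M)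

lemma entropy_transpose {M : Matrix n n ℂ} (h : M.IsHermitian) : entropy Mᵀ = entropy M := by
  rw [entropy_eq_charEntropy h, entropy_eq_charEntropy h.transpose, charEntropy, charEntropy,
    charpoly_transpose]

lemma isHermitian_diagonal_ofReal (d : n → ℝ) :
    (diagonal fun i => (d i : ℂ)).IsHermitian := by
  rw [IsHermitian, diagonal_conjTranspose]
  congr 1
  ext i
  simp

lemma entropy_diagonal (d : n → ℝ) : entropy (diagonal fun i => (d i : ℂ)) = ∑ i, eta (d i) := by
  rw [entropy_eq_charEntropy (isHermitian_diagonal_ofReal d), charEntropy, charpoly_diagonal,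
    Polynomial.roots_prod _ _ (Finset.prod_ne_zero_iff.2 fun i _ => Polynomial.X_sub_C_ne_zero _)]
  simp

lemma entropy_isometry {V : Matrix m n ℂ} (hV : Vᴴ * V = 1) {M : Matrix n n ℂ}
    (hM : M.IsHermitian) : entropy (V * M * Vᴴ) = entropy M := by
  have h : Vᴴ * (V * M) = M := by rw [← Matrix.mul_assoc, hV, Matrix.one_mul]
  rw [entropy_mul_comm (isHermitian_mul_mul_conjTranspose V hM) (by rwa [h]), h]

lemma entropy_isometry_diagonal {V : Matrix m n ℂ} (hV : Vᴴ * V = 1) (d : n → ℝ) :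
    entropy (V * (diagonal fun i => (d i : ℂ)) * Vᴴ) = ∑ i, eta (d i) := by
  rw [entropy_isometry hV (isHermitian_diagonal_ofReal d), entropy_diagonal]

/-- Spectral decomposition of a positive semidefinite matrix. -/
lemma exists_spectral {M : Matrix n n ℂ} (h : M.PosSemidef) :
    ∃ (U : Matrix n n ℂ) (d : n → ℝ), Uᴴ * U = 1 ∧ U * Uᴴ = 1 ∧ (∀ i, 0 ≤ d i) ∧
      M = U * (diagonal fun i => (d i : ℂ)) * Uᴴ := by
  refine ⟨h.1.eigenvectorUnitary, h.1.eigenvalues, ?_, ?_, h.eigenvalues_nonneg, ?_⟩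
  · exact Unitary.coe_star_mul_self _
  · exact Unitary.coe_mul_star_self _
  · exact h.1.spectral_theorem

lemma trace_isometry_diagonal {V : Matrix m n ℂ} (hV : Vᴴ * V = 1) (d : n → ℝ) :
    (V * (diagonal fun i => (d i : ℂ)) * Vᴴ).trace = ((∑ i, d i : ℝ) : ℂ) := by
  rw [trace_mul_cycle, hV, Matrix.one_mul, trace_diagonal]
  push_cast
  rfl

lemma entropy_nonneg {M : Matrix n n ℂ} (h : IsState M) : 0 ≤ entropy M := by
  obtain ⟨U, d, hU, -, hd, rfl⟩ := exists_spectral h.1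
  have ht : ∑ i, d i = 1 := by exact_mod_cast (trace_isometry_diagonal hU d).symm.trans h.2
  rw [entropy_isometry_diagonal hU]
  exact Finset.sum_nonneg fun i _ => eta_nonneg (hd i)
    (ht ▸ Finset.single_le_sum (fun j _ => hd j) (Finset.mem_univ i))

/-- The eigenvalues are the products d i * e j; `eta_mul` splits each term, and the unit traces
remove the weights. -/
lemma entropy_kronecker {M : Matrix m m ℂ} {N : Matrix n n ℂ} (hM : IsState M) (hN : IsState N) :
    entropy (M ⊗ₖ N) = entropy M + entropy N := by
  obtain ⟨U, d, hU, -, hd, rfl⟩ := exists_spectral hM.1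
  obtain ⟨V, e, hV, -, he, rfl⟩ := exists_spectral hN.1
  have hd1 : ∑ i, d i = 1 := by exact_mod_cast (trace_isometry_diagonal hU d).symm.trans hM.2
  have he1 : ∑ i, e i = 1 := by exact_mod_cast (trace_isometry_diagonal hV e).symm.trans hN.2
  have hUV : (U ⊗ₖ V)ᴴ * (U ⊗ₖ V) = 1 := by
    rw [conjTranspose_kronecker, ← mul_kronecker_mul, hU, hV, one_kronecker_one]
  have h := entropy_isometry_diagonal hUV (fun x : m × n => d x.1 * e x.2)
  rw [entropy_isometry_diagonal hU, entropy_isometry_diagonal hV, mul_kronecker_mul,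
    mul_kronecker_mul, diagonal_kronecker_diagonal, ← conjTranspose_kronecker]
  push_cast at h
  rw [h, Fintype.sum_prod_type]
  simp only [eta_mul, Finset.sum_add_distrib, ← Finset.mul_sum, ← Finset.sum_mul, he1, hd1, one_mul]

lemma proj_posSemidef (ψ : n → ℂ) : (proj ψ).PosSemidef := posSemidef_vecMulVec_self_star ψ

lemma trace_proj (ψ : n → ℂ) : (proj ψ).trace = ((∑ i, ‖ψ i‖ ^ 2 : ℝ) : ℂ) := by
  simp [proj, trace, vecMulVec, Complex.mul_conj, Complex.normSq_eq_norm_sq]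

lemma isState_proj {ψ : n → ℂ} (h : IsUnitVector ψ) : IsState (proj ψ) :=
  ⟨proj_posSemidef ψ, by rw [trace_proj, h, Complex.ofReal_one]⟩

lemma isUnitVector_of_trace {ψ : n → ℂ} (h : (proj ψ).trace = 1) : IsUnitVector ψ := by
  rw [trace_proj] at h
  exact_mod_cast h

lemma entropy_proj {ψ : n → ℂ} (h : IsUnitVector ψ) : entropy (proj ψ) = 0 := by
  have h2 : (replicateCol Unit ψ)ᴴ * replicateCol Unit ψ = diagonal fun _ => ((1 : ℝ) : ℂ) := by
    ext i j
    have : i = j := rfl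
    subst this
    rw [diagonal_apply_eq, ← h]
    simp [Matrix.mul_apply, Complex.conj_mul']
  have h1 : proj ψ = replicateCol Unit ψ * (replicateCol Unit ψ)ᴴ := by
    ext i j
    simp [Matrix.mul_apply, proj, vecMulVec]
  rw [h1, entropy_mul_conjTranspose, h2, entropy_diagonal]
  simp [eta_one]

end Entropy

/-! ### Partial traces and measurements. -/

section Measurement

variable {A B C : Type*} [Fintype A] [Fintype B] [Fintype C]
  [DecidableEq A] [DecidableEq B] [DecidableEq C]

/-- Cyclicity survives under a partial trace for operators acting on the traced factor alone; `X`
may be rectangular, so isometries can be moved. -/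
lemma traceB_cyclic (X : Matrix C B ℂ) (M : Matrix (A × B) (A × C) ℂ) :
    traceB (((1 : Matrix A A ℂ) ⊗ₖ X) * M) = traceB (M * ((1 : Matrix A A ℂ) ⊗ₖ X)) := by
  ext a a'
  simp only [traceB, of_apply, Matrix.mul_apply, kroneckerMap_apply, one_apply,
    Fintype.sum_prod_type, ite_mul, one_mul, zero_mul, mul_ite, mul_zero, Finset.sum_ite_irrel,
    Finset.sum_const_zero, Finset.sum_ite_eq, Finset.sum_ite_eq', Finset.mem_univ, if_true]
  rw [Finset.sum_comm]
  simp only [mul_comm]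

lemma postMeas_one (ρ : Matrix (A × B) (A × B) ℂ) : postMeas ρ 1 = traceB ρ := by
  rw [postMeas, one_kronecker_one, Matrix.one_mul]

/-- Moves an operator on the measured system from the state to the effect. With `E = 1` it also
computes marginals. -/
lemma postMeas_isometry (V : Matrix B C ℂ) (ω : Matrix (A × C) (A × C) ℂ) (E : Matrix B B ℂ) :
    postMeas (((1 : Matrix A A ℂ) ⊗ₖ V) * ω * ((1 : Matrix A A ℂ) ⊗ₖ V)ᴴ) E
      = postMeas ω (Vᴴ * E * V) := by
  have h : ((1 : Matrix A A ℂ) ⊗ₖ (Vᴴ * E * V)) * ω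
      = ((1 : Matrix A A ℂ) ⊗ₖ Vᴴ) * (((1 : Matrix A A ℂ) ⊗ₖ E) * ((1 : Matrix A A ℂ) ⊗ₖ V) * ω) := by
    rw [← Matrix.mul_assoc, ← Matrix.mul_assoc, ← mul_kronecker_mul, ← mul_kronecker_mul,
      Matrix.one_mul, Matrix.one_mul]
  have h' : ((1 : Matrix A A ℂ) ⊗ₖ E) * (((1 : Matrix A A ℂ) ⊗ₖ V) * ω *
        ((1 : Matrix A A ℂ) ⊗ₖ V)ᴴ)
      = ((1 : Matrix A A ℂ) ⊗ₖ E) * ((1 : Matrix A A ℂ) ⊗ₖ V) * ω * ((1 : Matrix A A ℂ) ⊗ₖ Vᴴ) := by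
    rw [conjTranspose_kronecker, conjTranspose_one]
    simp only [Matrix.mul_assoc]
  rw [postMeas, postMeas, h, h', traceB_cyclic]

lemma trace_traceB (M : Matrix (A × B) (A × B) ℂ) : (traceB M).trace = M.trace := by
  simp [traceB, trace, Fintype.sum_prod_type]

lemma prob_eq_trace (ρ : Matrix (A × B) (A × B) ℂ) (E : Matrix B B ℂ) :
    prob ρ E = (postMeas ρ E).trace.re := by
  rw [prob, postMeas, trace_traceB]

lemma traceB_posSemidef {M : Matrix (A × B) (A × B) ℂ} (h : M.PosSemidef) :
    (traceB M).PosSemidef := by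
  have : traceB M = ∑ b, M.submatrix (fun a => (a, b)) (fun a => (a, b)) := by
    ext a a'
    simp [traceB, Matrix.sum_apply]
  rw [this]
  exact posSemidef_sum _ fun b _ => h.submatrix _

lemma exists_eq_conjTranspose_mul_self {E : Matrix B B ℂ} (h : E.PosSemidef) :
    ∃ F : Matrix B B ℂ, E = Fᴴ * F := by
  obtain ⟨U, d, -, -, hd, rfl⟩ := exists_spectral h
  refine ⟨(diagonal fun i => ((√(d i) : ℝ) : ℂ)) * Uᴴ, ?_⟩
  rw [conjTranspose_mul, (isHermitian_diagonal_ofReal _).eq, conjTranspose_conjTranspose,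
    Matrix.mul_assoc U, Matrix.mul_assoc U, ← Matrix.mul_assoc (diagonal _) (diagonal _) Uᴴ,
    diagonal_mul_diagonal]
  congr 3
  ext i
  rw [← Complex.ofReal_mul, Real.mul_self_sqrt (hd i)]

lemma postMeas_posSemidef {ρ : Matrix (A × B) (A × B) ℂ} (hρ : ρ.PosSemidef)
    {E : Matrix B B ℂ} (hE : E.PosSemidef) : (postMeas ρ E).PosSemidef := by
  -- Half of the effect goes to each side of the state, which gives a partial trace of a positive
  -- operator.
  obtain ⟨F, rfl⟩ := exists_eq_conjTranspose_mul_self hE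
  have h := postMeas_isometry F ρ 1
  rw [Matrix.mul_one] at h
  rw [← h, postMeas_one]
  exact traceB_posSemidef (hρ.mul_mul_conjTranspose_same _)

lemma trace_eq_ofReal_re {M : Matrix A A ℂ} (h : M.PosSemidef) : M.trace = (M.trace.re : ℂ) :=
  Complex.ext rfl (by simpa using (Complex.le_def.1 h.trace_nonneg).2.symm)

lemma prob_nonneg {ρ : Matrix (A × B) (A × B) ℂ} (hρ : ρ.PosSemidef)
    {E : Matrix B B ℂ} (hE : E.PosSemidef) : 0 ≤ prob ρ E := by
  rw [prob_eq_trace]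
  exact (Complex.le_def.1 (postMeas_posSemidef hρ hE).trace_nonneg).1

/-- A nonzero positive semidefinite matrix, divided by its trace, is a state. -/
lemma isState_normalize {M : Matrix A A ℂ} (h : M.PosSemidef) (h0 : M.trace.re ≠ 0) :
    IsState (((M.trace.re)⁻¹ : ℂ) • M) := by
  have hp : 0 ≤ M.trace.re := (Complex.le_def.1 h.trace_nonneg).1
  refine ⟨h.smul ?_, ?_⟩
  · rw [← Complex.ofReal_inv]
    exact_mod_cast inv_nonneg.2 hp
  · rw [trace_smul, smul_eq_mul]
    conv_lhs => rw [trace_eq_ofReal_re h]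
    exact inv_mul_cancel₀ (Complex.ofReal_ne_zero.2 h0)

lemma entropy_term_nonneg {ρ : Matrix (A × B) (A × B) ℂ} (hρ : ρ.PosSemidef)
    {E : Matrix B B ℂ} (hE : E.PosSemidef) :
    0 ≤ prob ρ E * entropy (((prob ρ E)⁻¹ : ℂ) • postMeas ρ E) := by
  by_cases h0 : prob ρ E = 0
  · simp [h0]
  refine mul_nonneg (prob_nonneg hρ hE) (entropy_nonneg ?_)
  rw [prob_eq_trace] at h0 ⊢
  exact isState_normalize (postMeas_posSemidef hρ hE) h0

lemma condEntropy_nonneg {ρ : Matrix (A × B) (A × B) ℂ} (hρ : ρ.PosSemidef) {k : ℕ}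
    {E : Fin k → Matrix B B ℂ} (hE : IsPOVM E) : 0 ≤ condEntropy ρ E :=
  Finset.sum_nonneg fun i _ => entropy_term_nonneg hρ (hE.1 i)

lemma sum_prob {ρ : Matrix (A × B) (A × B) ℂ} (hρ : ρ.trace = 1) {k : ℕ}
    {E : Fin k → Matrix B B ℂ} (hE : IsPOVM E) : ∑ i, prob ρ (E i) = 1 := by
  have h : ∑ i, ((1 : Matrix A A ℂ) ⊗ₖ E i) = (1 : Matrix A A ℂ) ⊗ₖ ∑ i, E i := by
    ext x y
    simp [Matrix.sum_apply, Finset.mul_sum]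
  simp only [prob]
  rw [← Complex.re_sum, ← trace_sum, ← Finset.sum_mul, h, hE.2, one_kronecker_one, Matrix.one_mul,
    hρ, Complex.one_re]

/-- A rank-one outcome leaves a pure state; an outcome of probability 0 is harmless because of its
weight. -/
lemma entropy_normalize_proj (φ : A → ℂ) :
    (proj φ).trace.re * entropy ((((proj φ).trace.re)⁻¹ : ℂ) • proj φ) = 0 := by
  by_cases h0 : (proj φ).trace.re = 0
  · rw [h0, zero_mul]
  set t := (proj φ).trace.re with ht
  have hp : 0 ≤ t := (Complex.le_def.1 (proj_posSemidef φ).trace_nonneg).1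
  have h : ((t : ℂ)⁻¹) • proj φ = proj (((√t : ℂ)⁻¹) • φ) := by
    ext i j
    simp only [Matrix.smul_apply, proj, vecMulVec_apply, Pi.smul_apply, Pi.star_apply, smul_eq_mul,
      star_mul', star_inv₀, RCLike.star_def, Complex.conj_ofReal]
    have : ((√t : ℝ) : ℂ) * (√t : ℝ) = t := by rw [← Complex.ofReal_mul, Real.mul_self_sqrt hp]
    rw [← this, mul_inv]
    ring
  have hs := isState_normalize (proj_posSemidef φ) h0
  rw [← ht] at hs
  rw [h] at hs ⊢
  rw [entropy_proj (isUnitVector_of_trace hs.2), mul_zero]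

lemma isState_traceB {ρ : Matrix (A × B) (A × B) ℂ} (h : IsState ρ) : IsState (traceB ρ) :=
  ⟨traceB_posSemidef h.1, by rw [trace_traceB, h.2]⟩

lemma traceA_eq_traceB_swap (ρ : Matrix (A × B) (A × B) ℂ) : traceA ρ = traceB (swap ρ) := rfl

lemma isState_swap {ρ : Matrix (A × B) (A × B) ℂ} (h : IsState ρ) : IsState (swap ρ) := by
  refine ⟨h.1.submatrix _, ?_⟩
  rw [← h.2, swap, trace, trace]
  exact Fintype.sum_equiv (Equiv.prodComm B A) _ _ fun _ => rfl

lemma isState_traceA {ρ : Matrix (A × B) (A × B) ℂ} (h : IsState ρ) : IsState (traceA ρ) :=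
  isState_traceB (isState_swap h)

lemma entropy_submatrix (e : A ≃ B) {M : Matrix B B ℂ} (h : M.IsHermitian) :
    entropy (M.submatrix e e) = entropy M := by
  rw [entropy_eq_charEntropy h, entropy_eq_charEntropy (h.submatrix e), charEntropy, charEntropy,
    ← charpoly_reindex e.symm M]
  rfl

lemma entropy_swap {ρ : Matrix (A × B) (A × B) ℂ} (h : ρ.IsHermitian) :
    entropy (swap ρ) = entropy ρ := entropy_submatrix (Equiv.prodComm B A) h

/-- The two reduced states of a pure state have the same entropy. -/
lemma entropy_traceA_proj (ψ : A × B → ℂ) :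
    entropy (traceA (proj ψ)) = entropy (traceB (proj ψ)) := by
  -- The coefficient matrix: the marginals are ΨΨᴴ and the transpose of ΨᴴΨ, which have the same
  -- nonzero spectrum.
  set Ψ : Matrix A B ℂ := of fun a b => ψ (a, b) with hΨ
  have hB : traceB (proj ψ) = Ψ * Ψᴴ := by
    ext a a'
    simp [traceB, proj, vecMulVec_apply, hΨ, Matrix.mul_apply]
  have hA : traceA (proj ψ) = (Ψᴴ * Ψ)ᵀ := by
    ext b b'
    simp [traceA, proj, vecMulVec_apply, hΨ, Matrix.mul_apply, mul_comm]
  rw [hA, hB, entropy_transpose (isHermitian_conjTranspose_mul_self Ψ), entropy_mul_conjTranspose]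

lemma swap_mul (M N : Matrix (A × B) (A × B) ℂ) : swap (M * N) = swap M * swap N :=
  (submatrix_mul_equiv M N Prod.swap (Equiv.prodComm B A) Prod.swap).symm

lemma swap_conjTranspose (M : Matrix (A × B) (A × B) ℂ) : swap Mᴴ = (swap M)ᴴ := rfl

lemma traceB_kronecker_one_mul_mul (U U' : Matrix A A ℂ) (M : Matrix (A × B) (A × B) ℂ) :
    traceB ((U ⊗ₖ (1 : Matrix B B ℂ)) * M * (U' ⊗ₖ (1 : Matrix B B ℂ))) = U * traceB M * U' := by
  ext a a'
  simp only [traceB, of_apply, Matrix.mul_apply, kroneckerMap_apply, one_apply,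
    Fintype.sum_prod_type, ite_mul, zero_mul, mul_ite, mul_one, mul_zero, Finset.sum_ite_eq, Finset.sum_ite_eq',
    Finset.mem_univ, if_true, Finset.sum_mul, Finset.mul_sum]
  rw [Finset.sum_comm]
  refine Finset.sum_congr rfl fun c _ => ?_
  rw [Finset.sum_comm]

lemma traceB_unitary (U : Matrix A A ℂ) {V : Matrix B B ℂ} (hV : V * Vᴴ = 1)
    (τ : Matrix (A × B) (A × B) ℂ) :
    traceB ((U ⊗ₖ V)ᴴ * τ * (U ⊗ₖ V)) = Uᴴ * traceB τ * U := by
  have h1 : (U ⊗ₖ V)ᴴ = ((1 : Matrix A A ℂ) ⊗ₖ Vᴴ) * (Uᴴ ⊗ₖ (1 : Matrix B B ℂ)) := by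
    rw [conjTranspose_kronecker, ← mul_kronecker_mul, Matrix.one_mul, Matrix.mul_one]
  have h2 : U ⊗ₖ V * ((1 : Matrix A A ℂ) ⊗ₖ Vᴴ) = U ⊗ₖ (1 : Matrix B B ℂ) := by
    rw [← mul_kronecker_mul, Matrix.mul_one, hV]
  rw [h1, Matrix.mul_assoc, Matrix.mul_assoc, traceB_cyclic, Matrix.mul_assoc, Matrix.mul_assoc,
    h2, ← Matrix.mul_assoc, traceB_kronecker_one_mul_mul]

lemma traceA_unitary {U : Matrix A A ℂ} (hU : U * Uᴴ = 1) (V : Matrix B B ℂ)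
    (τ : Matrix (A × B) (A × B) ℂ) :
    traceA ((U ⊗ₖ V)ᴴ * τ * (U ⊗ₖ V)) = Vᴴ * traceA τ * V := by
  have h : swap (U ⊗ₖ V) = V ⊗ₖ U := by
    ext x y
    simp [swap, mul_comm]
  rw [traceA_eq_traceB_swap, swap_mul, swap_mul, swap_conjTranspose, h, traceB_unitary V hU,
    traceA_eq_traceB_swap]

/-- Measuring the first subsystem sums the blocks of the operator, weighted by the entries of `E`. -/
lemma postMeas_swap (ρ : Matrix (A × B) (A × B) ℂ) (E : Matrix A A ℂ) :
    postMeas (swap ρ) E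
      = ∑ a, ∑ a', E a a' • ρ.submatrix (fun b => (a', b)) (fun b => (a, b)) := by
  ext b b'
  simp only [postMeas, traceB, swap, of_apply, Matrix.mul_apply, kroneckerMap_apply, one_apply,
    Fintype.sum_prod_type, ite_mul, one_mul, zero_mul, Finset.sum_ite_irrel,
    Finset.sum_const_zero, Finset.sum_ite_eq, Finset.mem_univ, if_true, Matrix.sum_apply,
    Matrix.smul_apply, submatrix_apply, Prod.swap_prod_mk, smul_eq_mul]

lemma submatrix_isometry (V : Matrix B C ℂ) (ω : Matrix (A × C) (A × C) ℂ) (a a' : A) :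
    (((1 : Matrix A A ℂ) ⊗ₖ V) * ω * ((1 : Matrix A A ℂ) ⊗ₖ V)ᴴ).submatrix
        (fun b => (a, b)) (fun b => (a', b))
      = V * ω.submatrix (fun c => (a, c)) (fun c => (a', c)) * Vᴴ := by
  ext b b'
  simp only [submatrix_apply, Matrix.mul_apply, conjTranspose_apply, kroneckerMap_apply, one_apply,
    Fintype.sum_prod_type, ite_mul, one_mul, zero_mul, mul_ite, mul_zero, Finset.sum_ite_irrel,
    Finset.sum_const_zero, Finset.sum_ite_eq, Finset.mem_univ, if_true, apply_ite star, star_zero]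

end Measurement

/-! ### Klein's inequality and equality in subadditivity. -/

section Klein

variable {n A B : Type*} [Fintype n] [Fintype A] [Fintype B]
  [DecidableEq n] [DecidableEq A] [DecidableEq B]

/-- This is log x ≤ x - 1 at x = w / t; strictness for x ≠ 1 gives the equality case below. -/
lemma klein_scalar {t w : ℝ} (ht : 0 ≤ t) (hw : 0 < w) :
    t - w ≤ t * Real.log t - t * Real.log w := by
  rcases ht.eq_or_lt with rfl | ht
  · simp [hw.le]
  have h := Real.log_le_sub_one_of_pos (div_pos hw ht)
  rw [Real.log_div hw.ne' ht.ne'] at h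
  have := mul_le_mul_of_nonneg_left h ht.le
  have e : t * (w / t - 1) = w - t := by field_simp
  linarith

lemma klein_scalar_eq {t w : ℝ} (ht : 0 ≤ t) (hw : 0 < w)
    (h : t * Real.log t - t * Real.log w = t - w) : t = w := by
  by_contra hne
  rcases ht.eq_or_lt with rfl | ht
  · simp at h
    exact hne h.symm
  have h1 : w / t ≠ 1 := fun h1 => hne ((div_eq_one_iff_eq ht.ne').1 h1).symm
  have h2 := Real.log_lt_sub_one_of_pos (div_pos hw ht) h1
  rw [Real.log_div hw.ne' ht.ne'] at h2
  have := mul_lt_mul_of_pos_left h2 ht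
  have e : t * (w / t - 1) = w - t := by field_simp
  linarith

/-- The equality case of Klein's inequality for a doubly stochastic matrix `P`. -/
lemma klein_stochastic {P : n → n → ℝ} (hP : ∀ i j, 0 ≤ P i j) (hrow : ∀ i, ∑ j, P i j = 1)
    (hcol : ∀ j, ∑ i, P i j = 1) {t w : n → ℝ} (ht : ∀ i, 0 ≤ t i) (hw : ∀ j, 0 ≤ w j)
    (hsum : ∑ i, t i = ∑ j, w j) (hsupp : ∀ j, w j = 0 → ∑ i, t i * P i j = 0)
    (heq : ∑ i, t i * Real.log (t i) = ∑ j, (∑ i, t i * P i j) * Real.log (w j)) (i j : n)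
    (hij : P i j ≠ 0) : t i = w j := by
  have hzero : ∀ i j, w j = 0 → t i * P i j = 0 := fun i j hj =>
    (Finset.sum_eq_zero_iff_of_nonneg fun i _ => mul_nonneg (ht i) (hP i j)).1 (hsupp j hj) i
      (Finset.mem_univ i)
  -- The scalar Klein gaps weighted by `P`. They are nonnegative with total 0, so each vanishes.
  let g : n → n → ℝ := fun i j =>
    P i j * (t i * Real.log (t i) - t i * Real.log (w j) - (t i - w j))
  have hg : ∀ i j, 0 ≤ g i j := by
    intro i j
    -- For `w j = 0` the default value log 0 = 0 does no damage, since the support condition gives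
    -- `t i * P i j = 0`.
    rcases (hw j).eq_or_lt with h0 | h0
    · have : g i j = (t i * P i j) * (Real.log (t i) - Real.log (w j) - 1) + P i j * w j := by
        simp only [g]; ring
      rw [this, hzero i j h0.symm, ← h0]
      simp
    · exact mul_nonneg (hP i j) (by linarith [klein_scalar (ht i) h0])
  have hgs : ∑ i, ∑ j, g i j = 0 := by
    have e1 : ∀ i j, g i j = P i j * (t i * Real.log (t i) - t i)
        - (t i * P i j) * Real.log (w j) + P i j * w j := fun i j => by simp only [g]; ring
    simp only [e1, Finset.sum_add_distrib, Finset.sum_sub_distrib, ← Finset.sum_mul, hrow, one_mul]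
    rw [Finset.sum_comm (f := fun i j => t i * P i j * Real.log (w j)),
      Finset.sum_comm (f := fun i j => P i j * w j)]
    simp only [← Finset.sum_mul, hcol, one_mul]
    linarith
  have hgz : g i j = 0 := by
    have h1 := (Finset.sum_eq_zero_iff_of_nonneg fun i _ =>
      Finset.sum_nonneg fun j _ => hg i j).1 hgs i (Finset.mem_univ i)
    exact (Finset.sum_eq_zero_iff_of_nonneg fun j _ => hg i j).1 h1 j (Finset.mem_univ j)
  have h := (mul_eq_zero.1 hgz).resolve_left hij
  rcases (hw j).eq_or_lt with h0 | h0
  · rw [← h0]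
    exact (mul_eq_zero.1 (hzero i j h0.symm)).resolve_right hij
  · exact klein_scalar_eq (ht i) h0 (by linarith)

lemma sum_row_unitary {G : Matrix n n ℂ} (hG : G * Gᴴ = 1) (i : n) :
    ∑ j, ‖G i j‖ ^ 2 = 1 := by
  have h := congrFun (congrFun hG i) i
  rw [Matrix.mul_apply, one_apply_eq] at h
  simp only [conjTranspose_apply, RCLike.star_def, Complex.mul_conj'] at h
  exact_mod_cast h

lemma sum_col_unitary {G : Matrix n n ℂ} (hG : Gᴴ * G = 1) (j : n) :
    ∑ i, ‖G i j‖ ^ 2 = 1 := by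
  have h := congrFun (congrFun hG j) j
  rw [Matrix.mul_apply, one_apply_eq] at h
  simp only [conjTranspose_apply, RCLike.star_def, Complex.conj_mul'] at h
  exact_mod_cast h

/-- The equality case of Klein's inequality: `-Tr τ log ω = S(τ)` forces `τ = ω`. -/
lemma klein_eq {τ : Matrix n n ℂ} (hτ : IsState τ) {W : Matrix n n ℂ} (hW : Wᴴ * W = 1)
    (hW' : W * Wᴴ = 1) {w : n → ℝ} (hw : ∀ i, 0 ≤ w i) (hw1 : ∑ i, w i = 1)
    (hsupp : ∀ j, w j = 0 → ((Wᴴ * τ * W) j j).re = 0)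
    (heq : entropy τ = -∑ j, ((Wᴴ * τ * W) j j).re * Real.logb 2 (w j)) :
    τ = W * (diagonal fun i => (w i : ℂ)) * Wᴴ := by
  obtain ⟨U, t, hU, hU', ht, rfl⟩ := exists_spectral hτ.1
  have ht1 : ∑ i, t i = 1 := by exact_mod_cast (trace_isometry_diagonal hU t).symm.trans hτ.2
  -- Transition matrix between the two eigenbases; its squared moduli are doubly stochastic.
  set G : Matrix n n ℂ := Uᴴ * W with hG
  have hGc : Gᴴ = Wᴴ * U := by rw [hG, conjTranspose_mul, conjTranspose_conjTranspose]
  have hG1 : Gᴴ * G = 1 := by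
    rw [hGc, hG, Matrix.mul_assoc, ← Matrix.mul_assoc U, hU', Matrix.one_mul, hW]
  have hG2 : G * Gᴴ = 1 := by
    rw [hGc, hG, Matrix.mul_assoc, ← Matrix.mul_assoc W, hW', Matrix.one_mul, hU]
  have hWG : Wᴴ * (U * (diagonal fun i => (t i : ℂ)) * Uᴴ) * W
      = Gᴴ * (diagonal fun i => (t i : ℂ)) * G := by
    rw [hGc, hG]; simp only [Matrix.mul_assoc]
  have hd : ∀ j, ((Wᴴ * (U * (diagonal fun i => (t i : ℂ)) * Uᴴ) * W) j j).re
      = ∑ i, t i * ‖G i j‖ ^ 2 := by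
    intro j
    rw [hWG, Matrix.mul_apply, Complex.re_sum]
    refine Finset.sum_congr rfl fun i _ => ?_
    rw [mul_diagonal, conjTranspose_apply, mul_right_comm, RCLike.star_def, Complex.conj_mul',
      ← Complex.ofReal_pow, ← Complex.ofReal_mul, Complex.ofReal_re, mul_comm]
  simp only [hd] at hsupp heq
  rw [entropy_isometry_diagonal hU] at heq
  have hlog : ∑ i, t i * Real.log (t i) = ∑ j, (∑ i, t i * ‖G i j‖ ^ 2) * Real.log (w j) := by
    simp only [eta, Finset.sum_neg_distrib, neg_inj, Real.logb, ← mul_div_assoc,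
      ← Finset.sum_div] at heq
    exact (div_left_inj' (Real.log_pos (by norm_num)).ne').1 heq
  have key := klein_stochastic (P := fun i j => ‖G i j‖ ^ 2) (fun _ _ => by positivity)
    (sum_row_unitary hG2) (sum_col_unitary hG1) ht hw (ht1.trans hw1.symm) hsupp hlog
  -- `G` connects only equal eigenvalues, so it intertwines the two diagonal matrices.
  have hcomm : (diagonal fun i => (t i : ℂ)) * G = G * diagonal fun i => (w i : ℂ) := by
    ext i j
    rw [diagonal_mul, mul_diagonal]
    by_cases h : G i j = 0
    · simp [h]
    · rw [key i j (by simpa using h), mul_comm]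
  calc U * (diagonal fun i => (t i : ℂ)) * Uᴴ
      = U * ((diagonal fun i => (t i : ℂ)) * (Uᴴ * W)) * Wᴴ := by
        simp only [Matrix.mul_assoc, hW', Matrix.mul_one]
    _ = U * Uᴴ * W * (diagonal fun i => (w i : ℂ)) * Wᴴ := by
        rw [← hG, hcomm, hG]; simp only [Matrix.mul_assoc]
    _ = _ := by rw [hU', Matrix.one_mul]

/-- The equality case of the subadditivity of the entropy. -/
lemma eq_kronecker_of_entropy_eq {τ : Matrix (A × B) (A × B) ℂ} (hτ : IsState τ)
    (hA : IsState (traceB τ)) (hB : IsState (traceA τ))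
    (h : entropy τ = entropy (traceB τ) + entropy (traceA τ)) :
    τ = traceB τ ⊗ₖ traceA τ := by
  obtain ⟨U, l, hU, hU', hl, hUA⟩ := exists_spectral hA.1
  obtain ⟨V, q, hV, hV', hq, hVB⟩ := exists_spectral hB.1
  have hl1 : ∑ i, l i = 1 := by
    exact_mod_cast (trace_isometry_diagonal hU l).symm.trans (hUA ▸ hA.2)
  have hq1 : ∑ i, q i = 1 := by
    exact_mod_cast (trace_isometry_diagonal hV q).symm.trans (hVB ▸ hB.2)
  set W := U ⊗ₖ V with hWdef
  have hW : Wᴴ * W = 1 := by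
    rw [hWdef, conjTranspose_kronecker, ← mul_kronecker_mul, hU, hV, one_kronecker_one]
  have hW' : W * Wᴴ = 1 := by
    rw [hWdef, conjTranspose_kronecker, ← mul_kronecker_mul, hU', hV', one_kronecker_one]
  -- The diagonal of τ in the product eigenbasis: a joint distribution whose marginals are the
  -- spectra `l` and `q`.
  set d : A × B → ℝ := fun x => ((Wᴴ * τ * W) x x).re with hd
  have hd0 : ∀ x, 0 ≤ d x := fun x =>
    (Complex.le_def.1 (hτ.1.conjTranspose_mul_mul_same W).diag_nonneg).1
  have hUA' : Uᴴ * traceB τ * U = diagonal fun i => (l i : ℂ) := by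
    rw [hUA]
    simp only [Matrix.mul_assoc, hU, Matrix.mul_one]
    rw [← Matrix.mul_assoc, hU, Matrix.one_mul]
  have hVB' : Vᴴ * traceA τ * V = diagonal fun i => (q i : ℂ) := by
    rw [hVB]
    simp only [Matrix.mul_assoc, hV, Matrix.mul_one]
    rw [← Matrix.mul_assoc, hV, Matrix.one_mul]
  have hdA : ∀ j, ∑ k, d (j, k) = l j := by
    intro j
    have h1 := congrFun (congrFun (traceB_unitary U hV' τ) j) j
    rw [hUA', diagonal_apply_eq] at h1
    have h2 := congrArg Complex.re h1
    rwa [traceB, of_apply, Complex.re_sum, Complex.ofReal_re] at h2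
  have hdB : ∀ k, ∑ j, d (j, k) = q k := by
    intro k
    have h1 := congrFun (congrFun (traceA_unitary hU' V τ) k) k
    rw [hVB', diagonal_apply_eq] at h1
    have h2 := congrArg Complex.re h1
    rwa [traceA, of_apply, Complex.re_sum, Complex.ofReal_re] at h2
  have hdl : ∀ j k, l j = 0 → d (j, k) = 0 := fun j k hj =>
    (Finset.sum_eq_zero_iff_of_nonneg fun k _ => hd0 (j, k)).1 ((hdA j).trans hj) k
      (Finset.mem_univ k)
  have hdq : ∀ j k, q k = 0 → d (j, k) = 0 := fun j k hk =>
    (Finset.sum_eq_zero_iff_of_nonneg fun j _ => hd0 (j, k)).1 ((hdB k).trans hk) j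
      (Finset.mem_univ j)
  have key := klein_eq hτ hW hW' (w := fun x => l x.1 * q x.2)
    (fun x => mul_nonneg (hl _) (hq _))
    (by rw [Fintype.sum_prod_type]; simp only [← Finset.mul_sum, hq1, mul_one, hl1]) ?_ ?_
  · rw [hUA, hVB, mul_kronecker_mul, mul_kronecker_mul, diagonal_kronecker_diagonal,
      ← conjTranspose_kronecker]
    push_cast at key
    exact key
  · rintro ⟨j, k⟩ hjk
    rcases mul_eq_zero.1 hjk with h0 | h0
    · exact hdl j k h0
    · exact hdq j k h0
  -- The logarithm splits only for nonzero factors; elsewhere the joint weight is 0.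
  · have hterm : ∀ j k, d (j, k) * Real.logb 2 (l j * q k)
        = d (j, k) * Real.logb 2 (l j) + d (j, k) * Real.logb 2 (q k) := by
      intro j k
      by_cases h1 : l j = 0
      · simp [hdl j k h1]
      by_cases h2 : q k = 0
      · simp [hdq j k h2]
      rw [Real.logb_mul h1 h2, mul_add]
    have hA' : entropy (traceB τ) = ∑ j, eta (l j) := by rw [hUA, entropy_isometry_diagonal hU]
    have hB' : entropy (traceA τ) = ∑ j, eta (q j) := by rw [hVB, entropy_isometry_diagonal hV]
    change _ = -∑ x, d x * Real.logb 2 (l x.1 * q x.2)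
    rw [h, hA', hB', Fintype.sum_prod_type]
    simp only [hterm, Finset.sum_add_distrib]
    rw [Finset.sum_comm (f := fun j k => d (j, k) * Real.logb 2 (q k))]
    simp only [← Finset.sum_mul, hdA, hdB, eta, Finset.sum_neg_distrib, neg_add]

end Klein

/-! ### Pure states, ensembles and basis measurements. -/

section Vectors

variable {m n : Type*} [Fintype m] [Fintype n] [DecidableEq m] [DecidableEq n]

lemma proj_mulVec (M : Matrix m n ℂ) (v : n → ℂ) : proj (M *ᵥ v) = M * proj v * Mᴴ := by
  rw [proj, proj, mul_vecMulVec, vecMulVec_mul, star_mulVec]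

lemma proj_mul_self {ψ : n → ℂ} (h : IsUnitVector ψ) : proj ψ * proj ψ = proj ψ := by
  have h1 : star ψ ⬝ᵥ ψ = 1 := by
    have h2 := trace_proj ψ
    rw [h, proj, trace_vecMulVec, dotProduct_comm] at h2
    simpa using h2
  rw [proj, vecMulVec_mul_vecMulVec, h1, one_smul]

lemma eq_zero_of_trace_proj {v : n → ℂ} (h : (proj v).trace = 0) : v = 0 := by
  rw [trace_proj] at h
  have h' : ∑ i, ‖v i‖ ^ 2 = 0 := by exact_mod_cast h
  ext i
  have := (Finset.sum_eq_zero_iff_of_nonneg fun i _ => by positivity).1 h' i (Finset.mem_univ i)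
  simpa using this

/-- A matrix that annihilates a state annihilates the vectors of its pure ensembles. -/
lemma mulVec_eq_zero_of_ensemble {ρ : Matrix n n ℂ} {k : ℕ} {p : Fin k → ℝ} {φ : Fin k → n → ℂ}
    (h : IsPureEnsemble ρ p φ) {N : Matrix m n ℂ} (hN : N * ρ = 0) (i : Fin k) (hi : p i ≠ 0) :
    N *ᵥ φ i = 0 := by
  -- Conjugating ρ by `N` gives a vanishing sum of positive operators; its trace is a sum of squared
  -- norms.
  have h1 : ∑ i, (p i : ℂ) • proj (N *ᵥ φ i) = 0 := by
    rw [← Matrix.zero_mul (Nᴴ), ← hN, h.2.2.2, Matrix.mul_sum, Matrix.sum_mul]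
    refine Finset.sum_congr rfl fun i _ => ?_
    rw [proj_mulVec, Matrix.mul_smul, Matrix.smul_mul]
  have h2 := congrArg trace h1
  simp only [trace_sum, trace_smul, trace_proj, trace_zero, smul_eq_mul] at h2
  have h3 : ∑ i, p i * ∑ j, ‖(N *ᵥ φ i) j‖ ^ 2 = 0 := by exact_mod_cast h2
  have h4 := (Finset.sum_eq_zero_iff_of_nonneg fun i _ => mul_nonneg (h.1 i)
    (Finset.sum_nonneg fun j _ => by positivity)).1 h3 i (Finset.mem_univ i)
  refine eq_zero_of_trace_proj ?_
  rw [trace_proj, (mul_eq_zero.1 h4).resolve_left hi, Complex.ofReal_zero]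

lemma exists_pureEnsemble {ρ : Matrix n n ℂ} (h : IsState ρ) :
    ∃ (k : ℕ) (p : Fin k → ℝ) (φ : Fin k → n → ℂ), IsPureEnsemble ρ p φ := by
  obtain ⟨U, d, hU, -, hd, rfl⟩ := exists_spectral h.1
  have hd1 : ∑ i, d i = 1 := by exact_mod_cast (trace_isometry_diagonal hU d).symm.trans h.2
  let e := (Fintype.equivFin n).symm
  refine ⟨Fintype.card n, fun i => d (e i), fun i a => U a (e i), fun i => hd _, ?_, fun i => ?_, ?_⟩
  · rw [e.sum_comp, hd1]
  · exact sum_col_unitary hU (e i)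
  · rw [e.sum_comp (fun i => (d i : ℂ) • proj fun a => U a i)]
    ext a b
    rw [Matrix.mul_apply]
    simp only [mul_diagonal, Matrix.sum_apply, Matrix.smul_apply, proj,
      vecMulVec_apply, Pi.star_apply, conjTranspose_apply, smul_eq_mul]
    exact Finset.sum_congr rfl fun i _ => by ring

lemma sum_single_one : ∑ i : n, single i i (1 : ℂ) = 1 := by
  ext a b
  simp [Matrix.sum_apply, single_apply, one_apply, ite_and]

lemma single_posSemidef (i : n) : (single i i (1 : ℂ)).PosSemidef := by
  have : single i i (1 : ℂ) = proj (Pi.single i 1) := by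
    ext a b
    simp [proj, vecMulVec_apply, single_apply, Pi.single_apply, ite_and, eq_comm (a := i)]
    grind
  rw [this]
  exact proj_posSemidef _

lemma swap_proj (ψ : m × n → ℂ) : swap (proj ψ) = proj (fun x => ψ x.swap) := rfl

lemma postMeas_proj_single (ψ : m × n → ℂ) (i : n) :
    postMeas (proj ψ) (single i i 1) = proj fun a => ψ (a, i) := by
  ext a a'
  simp only [postMeas, traceB, of_apply, Matrix.mul_apply, kroneckerMap_apply, one_apply,
    Fintype.sum_prod_type, ite_mul, one_mul, zero_mul, Finset.sum_ite_irrel, Finset.sum_const_zero,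
    Finset.sum_ite_eq, Finset.mem_univ, if_true, single_apply, ite_and]
  rfl

lemma prob_mul_entropy_single (ψ : m × n → ℂ) (i : n) :
    prob (proj ψ) (single i i 1)
      * entropy (((prob (proj ψ) (single i i 1))⁻¹ : ℂ) • postMeas (proj ψ) (single i i 1)) = 0 := by
  rw [prob_eq_trace, postMeas_proj_single, entropy_normalize_proj]

end Vectors

/-! ### Consequences of the product form. -/

section Form

variable {A B C R : Type*} [Fintype A] [Fintype B] [Fintype C] [Fintype R]
  [DecidableEq A] [DecidableEq B] [DecidableEq C] [DecidableEq R]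

/-- The product of an operator on `A ⊗ C` and an operator on `R`, on `A ⊗ (C ⊗ R)`. -/
def tensor (P : Matrix (A × C) (A × C) ℂ) (σ : Matrix R R ℂ) :
    Matrix (A × C × R) (A × C × R) ℂ :=
  (P ⊗ₖ σ).submatrix (Equiv.prodAssoc A C R).symm (Equiv.prodAssoc A C R).symm

lemma tensor_mul (P P' : Matrix (A × C) (A × C) ℂ) (σ σ' : Matrix R R ℂ) :
    tensor P σ * tensor P' σ' = tensor (P * P') (σ * σ') := by
  rw [tensor, tensor, submatrix_mul_equiv, ← mul_kronecker_mul]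
  rfl

lemma postMeas_tensor (P : Matrix (A × C) (A × C) ℂ) (σ : Matrix R R ℂ) (G : Matrix C C ℂ) :
    postMeas (tensor P σ) (G ⊗ₖ (1 : Matrix R R ℂ)) = σ.trace • postMeas P G := by
  ext a a'
  simp only [postMeas, tensor, traceB, of_apply, Matrix.mul_apply, kroneckerMap_apply, one_apply,
    Fintype.sum_prod_type, ite_mul, one_mul, zero_mul, mul_ite, mul_one, mul_zero,
    Finset.sum_ite_irrel, Finset.sum_const_zero,
    Finset.sum_ite_eq, Finset.mem_univ, if_true, submatrix_apply, Matrix.smul_apply, smul_eq_mul,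
    Equiv.prodAssoc_symm_apply, trace, diag_apply, Finset.sum_mul, Finset.mul_sum]
  refine Finset.sum_congr rfl fun c _ => ?_
  rw [Finset.sum_comm]
  refine Finset.sum_congr rfl fun c' _ => Finset.sum_congr rfl fun k _ => ?_
  ring

lemma tensor_posSemidef {P : Matrix (A × C) (A × C) ℂ} {σ : Matrix R R ℂ} (hP : P.PosSemidef)
    (hσ : IsState σ) : (tensor P σ).PosSemidef := (hP.kronecker hσ.1).submatrix _

lemma isometry_one_kronecker {V : Matrix B C ℂ} (hV : Vᴴ * V = 1) :
    ((1 : Matrix A A ℂ) ⊗ₖ V)ᴴ * ((1 : Matrix A A ℂ) ⊗ₖ V) = 1 := by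
  rw [conjTranspose_kronecker, ← mul_kronecker_mul, hV, conjTranspose_one, Matrix.one_mul,
    one_kronecker_one]

lemma traceB_isometry_tensor {V : Matrix B (C × R) ℂ} (hV : Vᴴ * V = 1)
    (P : Matrix (A × C) (A × C) ℂ) (σ : Matrix R R ℂ) :
    traceB (((1 : Matrix A A ℂ) ⊗ₖ V) * tensor P σ * ((1 : Matrix A A ℂ) ⊗ₖ V)ᴴ)
      = σ.trace • traceB P := by
  rw [← postMeas_one, postMeas_isometry, Matrix.mul_one, hV, ← one_kronecker_one, postMeas_tensor,
    postMeas_one]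

/-- A measurement of A only combines the B-blocks of the state, and each block carries the same `V`
and `σ`. -/
lemma postMeas_swap_isometry_tensor (V : Matrix B (C × R) ℂ)
    (P : Matrix (A × C) (A × C) ℂ) (σ : Matrix R R ℂ) (E : Matrix A A ℂ) :
    postMeas (swap (((1 : Matrix A A ℂ) ⊗ₖ V) * tensor P σ * ((1 : Matrix A A ℂ) ⊗ₖ V)ᴴ)) E
      = V * (postMeas (swap P) E ⊗ₖ σ) * Vᴴ := by
  have h : ∀ a a', (tensor P σ).submatrix (fun c => (a, c)) (fun c => (a', c))
      = P.submatrix (fun c => (a, c)) (fun c => (a', c)) ⊗ₖ σ := fun a a' => rfl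
  have h' : (∑ a, ∑ a', E a a' • P.submatrix (fun c => (a', c)) (fun c => (a, c))) ⊗ₖ σ
      = ∑ a, ∑ a', E a a' • (P.submatrix (fun c => (a', c)) (fun c => (a, c)) ⊗ₖ σ) := by
    ext x y
    simp only [kroneckerMap_apply, Matrix.sum_apply, Matrix.smul_apply, Finset.sum_mul,
      smul_eq_mul, mul_assoc]
  rw [postMeas_swap, postMeas_swap, h']
  simp only [submatrix_isometry, h, Matrix.mul_sum, Matrix.sum_mul, Matrix.mul_smul,
    Matrix.smul_mul]

variable {l r : ℕ} {ρ : Matrix (A × B) (A × B) ℂ} {V : Matrix B (Fin l × Fin r) ℂ}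
  {ψ : A × Fin l → ℂ} {σ : Matrix (Fin r) (Fin r) ℂ}

lemma HasForm.eq (h : HasForm ρ V ψ σ) :
    ρ = ((1 : Matrix A A ℂ) ⊗ₖ V) * tensor (proj ψ) σ * ((1 : Matrix A A ℂ) ⊗ₖ V)ᴴ := h.2.2.2

lemma HasForm.traceB_eq (h : HasForm ρ V ψ σ) : traceB ρ = traceB (proj ψ) := by
  rw [h.eq, traceB_isometry_tensor h.1, h.2.2.1.2, one_smul]

lemma HasForm.postMeas_swap_eq (h : HasForm ρ V ψ σ) (E : Matrix A A ℂ) :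
    postMeas (swap ρ) E = V * (postMeas (swap (proj ψ)) E ⊗ₖ σ) * Vᴴ := by
  rw [h.eq, postMeas_swap_isometry_tensor]

lemma HasForm.entropy_eq (h : HasForm ρ V ψ σ) : entropy ρ = entropy σ := by
  have hs := isState_proj h.2.1
  rw [h.eq, entropy_isometry (isometry_one_kronecker h.1) (tensor_posSemidef hs.1 h.2.2.1).1, tensor,
    entropy_submatrix _ (hs.1.kronecker h.2.2.1.1).1, entropy_kronecker hs h.2.2.1,
    entropy_proj h.2.1, zero_add]

lemma HasForm.entropy_traceA (h : HasForm ρ V ψ σ) :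
    entropy (traceA ρ) = entropy (traceB ρ) + entropy σ := by
  have hs := isState_traceA (isState_proj h.2.1)
  have he := h.postMeas_swap_eq 1
  rw [postMeas_one, postMeas_one, ← traceA_eq_traceB_swap, ← traceA_eq_traceB_swap] at he
  rw [he, entropy_isometry h.1 (hs.1.kronecker h.2.2.1.1).1, entropy_kronecker hs h.2.2.1,
    entropy_traceA_proj, h.traceB_eq]

lemma HasForm.prob_swap (h : HasForm ρ V ψ σ) (E : Matrix A A ℂ) :
    prob (swap ρ) E = prob (swap (proj ψ)) E := by
  rw [prob_eq_trace, prob_eq_trace, h.postMeas_swap_eq, trace_mul_cycle, h.1, Matrix.one_mul,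
    trace_kronecker, h.2.2.1.2, mul_one]

/-- Each conditional state is an isometric image of one for ψ tensored with σ; the weights of S(σ)
add up to 1. -/
lemma HasForm.condEntropy_swap (h : HasForm ρ V ψ σ) {k : ℕ} {E : Fin k → Matrix A A ℂ}
    (hE : IsPOVM E) : condEntropy (swap ρ) E = entropy σ + condEntropy (swap (proj ψ)) E := by
  have hs := isState_swap (isState_proj h.2.1)
  have hterm : ∀ i, prob (swap ρ) (E i)
        * entropy (((prob (swap ρ) (E i))⁻¹ : ℂ) • postMeas (swap ρ) (E i))
      = prob (swap (proj ψ)) (E i) * entropy σ + prob (swap (proj ψ)) (E i)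
        * entropy (((prob (swap (proj ψ)) (E i))⁻¹ : ℂ) • postMeas (swap (proj ψ)) (E i)) := by
    intro i
    rw [h.prob_swap, ← mul_add]
    by_cases h0 : prob (swap (proj ψ)) (E i) = 0
    · simp [h0]
    have hn : IsState (((prob (swap (proj ψ)) (E i))⁻¹ : ℂ) • postMeas (swap (proj ψ)) (E i)) := by
      rw [prob_eq_trace] at h0 ⊢
      exact isState_normalize (postMeas_posSemidef hs.1 (hE.1 i)) h0
    rw [h.postMeas_swap_eq, ← Matrix.smul_mul, ← Matrix.mul_smul, ← smul_kronecker,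
      entropy_isometry h.1 (hn.1.kronecker h.2.2.1.1).1, entropy_kronecker hn h.2.2.1,
      add_comm (entropy σ)]
  rw [condEntropy, Finset.sum_congr rfl fun i _ => hterm i, Finset.sum_add_distrib,
    ← Finset.sum_mul, sum_prob hs.2 hE, one_mul, condEntropy]

/-- Measuring `A` in any basis is optimal. -/
lemma HasForm.isGreatest_swap (h : HasForm ρ V ψ σ) :
    IsGreatest (measGains (swap ρ)) (entropy (traceB ρ)) := by
  have hB : entropy (traceB (swap ρ)) = entropy (traceB ρ) + entropy σ := by
    rw [← traceA_eq_traceB_swap, h.entropy_traceA]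
  constructor
  · let e := (Fintype.equivFin A).symm
    have hE : IsPOVM fun i => single (e i) (e i) (1 : ℂ) :=
      ⟨fun i => single_posSemidef _, by
        rw [e.sum_comp fun a => single a a (1 : ℂ), sum_single_one]⟩
    refine ⟨_, _, hE, ?_⟩
    have h0 : condEntropy (swap (proj ψ)) (fun i => single (e i) (e i) (1 : ℂ)) = 0 :=
      Finset.sum_eq_zero fun i _ => by rw [swap_proj]; exact prob_mul_entropy_single _ _
    rw [h.condEntropy_swap hE, h0, hB]
    ring
  · rintro x ⟨k, E, hE, rfl⟩
    have := condEntropy_nonneg (isState_swap (isState_proj h.2.1)).1 hE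
    rw [h.condEntropy_swap hE, hB]
    linarith

/-- Measuring `B^L` in the standard basis is optimal. -/
lemma HasForm.isGreatest (hρ : IsState ρ) (h : HasForm ρ V ψ σ) :
    IsGreatest (measGains ρ) (entropy (traceB ρ)) := by
  constructor
  · let F : Fin l → Matrix B B ℂ := fun i =>
      V * (single i i (1 : ℂ) ⊗ₖ (1 : Matrix (Fin r) (Fin r) ℂ)) * Vᴴ
    -- The effects `F` sum only to the projection onto the range of `V`. The complement is added as
    -- outcome 0, which has probability 0.
    let E : Fin (l + 1) → Matrix B B ℂ := Fin.cons (1 - V * Vᴴ) F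
    have hid : (1 - V * Vᴴ) = (1 - V * Vᴴ) * (1 - V * Vᴴ)ᴴ := by
      have h1 : V * Vᴴ * (V * Vᴴ) = V * Vᴴ := by
        rw [Matrix.mul_assoc, ← Matrix.mul_assoc Vᴴ, h.1, Matrix.one_mul]
      rw [conjTranspose_sub, conjTranspose_one, conjTranspose_mul, conjTranspose_conjTranspose,
        Matrix.mul_sub, Matrix.sub_mul, Matrix.sub_mul, h1]
      simp
    have hE : IsPOVM E := by
      refine ⟨fun i => Fin.cases (motive := fun i => (E i).PosSemidef) ?_ (fun i => ?_) i, ?_⟩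
      · change (1 - V * Vᴴ).PosSemidef
        rw [hid]
        exact posSemidef_self_mul_conjTranspose _
      · exact ((single_posSemidef i).kronecker PosSemidef.one).mul_mul_conjTranspose_same V
      · have hF : ∑ i, F i = V * Vᴴ := by
          have hk : ∑ i : Fin l, (single i i (1 : ℂ) ⊗ₖ (1 : Matrix (Fin r) (Fin r) ℂ)) = 1 := by
            rw [← one_kronecker_one, ← sum_single_one (n := Fin l)]
            ext x y
            simp [Matrix.sum_apply, Finset.sum_mul]
          rw [← Matrix.sum_mul, ← Matrix.mul_sum, hk, Matrix.mul_one]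
        rw [Fin.sum_univ_succ]
        change (1 - V * Vᴴ) + ∑ i, F i = 1
        rw [hF, sub_add_cancel]
    refine ⟨_, E, hE, ?_⟩
    have h0 : postMeas ρ (E 0) = 0 := by
      change postMeas ρ (1 - V * Vᴴ) = 0
      rw [h.eq, postMeas_isometry, Matrix.mul_sub, Matrix.sub_mul, Matrix.mul_one,
        ← Matrix.mul_assoc, h.1, Matrix.one_mul, h.1, sub_self, postMeas, kronecker_zero,
        Matrix.zero_mul]
      ext a a'
      simp [traceB]
    have hs : ∀ i : Fin l, postMeas ρ (E i.succ) = postMeas (proj ψ) (single i i 1) := by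
      intro i
      change postMeas ρ (V * (single i i (1 : ℂ) ⊗ₖ (1 : Matrix (Fin r) (Fin r) ℂ)) * Vᴴ) = _
      have hc : Vᴴ * (V * (single i i (1 : ℂ) ⊗ₖ (1 : Matrix (Fin r) (Fin r) ℂ)) * Vᴴ) * V
          = single i i (1 : ℂ) ⊗ₖ (1 : Matrix (Fin r) (Fin r) ℂ) := by
        simp only [Matrix.mul_assoc, h.1, Matrix.mul_one]
        rw [← Matrix.mul_assoc, h.1, Matrix.one_mul]
      rw [h.eq, postMeas_isometry, hc, postMeas_tensor, h.2.2.1.2, one_smul]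
    have hcond : condEntropy ρ E = 0 := by
      rw [condEntropy, Fin.sum_univ_succ]
      simp only [prob_eq_trace, h0, hs, trace_zero, Complex.zero_re, zero_mul, zero_add]
      refine Finset.sum_eq_zero fun i _ => ?_
      rw [← prob_eq_trace]
      exact prob_mul_entropy_single _ _
    rw [hcond, sub_zero]
  · rintro x ⟨k, E, hE, rfl⟩
    linarith [condEntropy_nonneg hρ.1 hE]

/-- Exhibits the image as ψ tensored with a vector of B^R, the contraction of `v` with ψ. -/
lemma tensor_proj_one_mulVec (v : A × Fin l × Fin r → ℂ) :
    tensor (proj ψ) (1 : Matrix (Fin r) (Fin r) ℂ) *ᵥ v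
      = fun x => ψ (x.1, x.2.1) * ∑ y, star (ψ y) * v (y.1, y.2, x.2.2) := by
  ext ⟨a, j, k⟩
  simp only [tensor, mulVec, dotProduct, submatrix_apply, Equiv.prodAssoc_symm_apply,
    kroneckerMap_apply, proj, vecMulVec_apply, Pi.star_apply, one_apply, Fintype.sum_prod_type,
    mul_ite, mul_one, mul_zero, ite_mul, zero_mul, Finset.sum_ite_eq, Finset.mem_univ, if_true,
    Finset.mul_sum, mul_assoc]

lemma proj_tensor (χ : Fin r → ℂ) :
    proj (fun x : A × Fin l × Fin r => ψ (x.1, x.2.1) * χ x.2.2) = tensor (proj ψ) (proj χ) := by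
  ext x y
  simp only [proj, tensor, vecMulVec_apply, Pi.star_apply, star_mul', submatrix_apply,
    kroneckerMap_apply, Equiv.prodAssoc_symm_apply]
  ring

/-- Every vector of a pure ensemble has the same reduced state. -/
lemma HasForm.traceB_ensemble (h : HasForm ρ V ψ σ) {k : ℕ} {p : Fin k → ℝ}
    {φ : Fin k → A × B → ℂ} (hp : IsPureEnsemble ρ p φ) (i : Fin k) (hi : p i ≠ 0) :
    traceB (proj (φ i)) = traceB ρ := by
  set W := (1 : Matrix A A ℂ) ⊗ₖ V with hW
  set K := tensor (proj ψ) (1 : Matrix (Fin r) (Fin r) ℂ) with hK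
  have hWW : Wᴴ * W = 1 := isometry_one_kronecker h.1
  -- `W * K * Wᴴ` fixes ρ, hence fixes every ensemble vector of nonzero weight, which must then be
  -- an image of ψ ⊗ χ.
  have hN : (1 - W * K * Wᴴ) * ρ = 0 := by
    have h1 : W * K * Wᴴ * ρ = ρ := by
      have h2 : ρ = W * tensor (proj ψ) σ * Wᴴ := h.eq
      conv_lhs => rw [h2]
      calc W * K * Wᴴ * (W * tensor (proj ψ) σ * Wᴴ)
          = W * K * (Wᴴ * W) * tensor (proj ψ) σ * Wᴴ := by simp only [Matrix.mul_assoc]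
        _ = W * (K * tensor (proj ψ) σ) * Wᴴ := by
          rw [hWW, Matrix.mul_one, Matrix.mul_assoc W]
        _ = ρ := by rw [hK, tensor_mul, proj_mul_self h.2.1, Matrix.one_mul, ← h2]
    rw [Matrix.sub_mul, Matrix.one_mul, h1, sub_self]
  have h3 := mulVec_eq_zero_of_ensemble hp hN i hi
  rw [sub_mulVec, one_mulVec, sub_eq_zero, ← mulVec_mulVec, ← mulVec_mulVec, hK,
    tensor_proj_one_mulVec] at h3
  have h4 : proj (φ i) = W * tensor (proj ψ) (proj fun k => ∑ y : A × Fin l,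
      star (ψ y) * (Wᴴ *ᵥ φ i) (y.1, y.2, k)) * Wᴴ := by
    rw [← proj_tensor, ← proj_mulVec, ← h3]
  have h5 : traceB (proj (φ i)) = _ := (congrArg traceB h4).trans (traceB_isometry_tensor h.1 _ _)
  -- Comparing traces shows that the B^R factor has norm 1.
  have h6 := congrArg trace h5
  rw [trace_traceB, (isState_proj (hp.2.2.1 i)).2, trace_smul, trace_traceB,
    (isState_proj h.2.1).2, smul_eq_mul, mul_one] at h6
  rw [h5, ← h6, one_smul, h.traceB_eq]

lemma HasForm.avgEntanglements_eq (hρ : IsState ρ) (h : HasForm ρ V ψ σ) :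
    avgEntanglements ρ = {entropy (traceB ρ)} := by
  have key : ∀ (k : ℕ) (p : Fin k → ℝ) (φ : Fin k → A × B → ℂ), IsPureEnsemble ρ p φ →
      ∑ i, p i * entropy (traceB (proj (φ i))) = entropy (traceB ρ) := by
    intro k p φ hp
    rw [← one_mul (entropy (traceB ρ)), ← hp.2.1, Finset.sum_mul]
    refine Finset.sum_congr rfl fun i _ => ?_
    by_cases hi : p i = 0
    · simp [hi]
    · rw [h.traceB_ensemble hp i hi]
  ext x
  constructor
  · rintro ⟨k, p, φ, hp, rfl⟩
    exact key k p φ hp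
  · rintro rfl
    -- Some ensemble must exist, so that the set is a singleton and not empty.
    obtain ⟨k, p, φ, hp⟩ := exists_pureEnsemble hρ
    exact ⟨k, p, φ, hp, (key k p φ hp).symm⟩

lemma HasForm.entropy_sub (h : HasForm ρ V ψ σ) :
    entropy (traceA ρ) - entropy (traceB ρ) = entropy ρ := by
  rw [h.entropy_traceA, h.entropy_eq, add_sub_cancel_left]

lemma HasForm.discord_eq (hρ : IsState ρ) (h : HasForm ρ V ψ σ) :
    discord ρ = entropy (traceB ρ) := by
  rw [discord, classicalCorr, (h.isGreatest hρ).csSup_eq, mutualInfo, ← h.entropy_sub]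
  ring

lemma HasForm.discord_swap_eq (hρ : IsState ρ) (h : HasForm ρ V ψ σ) :
    discord (swap ρ) = entropy (traceB ρ) := by
  have h1 : traceA (swap ρ) = traceB ρ := rfl
  rw [discord, classicalCorr, h.isGreatest_swap.csSup_eq, mutualInfo, ← traceA_eq_traceB_swap, h1,
    entropy_swap hρ.1.1, ← h.entropy_sub]
  ring

end Form

/-! ### From the entropy equality to the product form. -/

section Structure

variable {n A B : Type*} [Fintype n] [Fintype A] [Fintype B]
  [DecidableEq n] [DecidableEq A] [DecidableEq B]

/-- Spectral decomposition of a positive semidefinite matrix, without the kernel. -/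
lemma exists_thin_spectral {M : Matrix n n ℂ} (h : M.PosSemidef) :
    ∃ (r : ℕ) (V : Matrix n (Fin r) ℂ) (d : Fin r → ℝ), Vᴴ * V = 1 ∧ (∀ i, 0 < d i) ∧
      M = V * (diagonal fun i => (d i : ℂ)) * Vᴴ := by
  obtain ⟨U, d, hU, -, hd, rfl⟩ := exists_spectral h
  let e := (Fintype.equivFin {i // d i ≠ 0}).symm
  refine ⟨_, U.submatrix id fun k => (e k : n), fun k => d (e k), ?_,
    fun k => (hd _).lt_of_ne' (e k).2, ?_⟩
  · ext i j
    have h1 := congrFun (congrFun hU (e i)) (e j)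
    rw [Matrix.mul_apply] at h1 ⊢
    simp only [conjTranspose_apply, submatrix_apply, id] at h1 ⊢
    rw [h1]
    simp [one_apply, Subtype.val_inj]
  · ext a b
    simp only [Matrix.mul_apply (M := U * _), Matrix.mul_apply (M := submatrix U _ _ * _),
      mul_diagonal, conjTranspose_apply, submatrix_apply, id]
    rw [e.sum_comp (fun i : {i // d i ≠ 0} => U a i * (d i : ℂ) * star (U b i)),
      ← Finset.sum_subtype (Finset.univ.filter fun i => d i ≠ 0) (by simp)
        (fun i => U a i * (d i : ℂ) * star (U b i)), Finset.sum_filter_of_ne]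
    intro i _ hi h0
    simp [h0] at hi

lemma range_mul_diagonal_mul_conjTranspose {m : Type*} [Fintype m] [DecidableEq m]
    {V : Matrix n m ℂ} (hV : Vᴴ * V = 1) {d : m → ℂ} (hd : ∀ i, d i ≠ 0) :
    LinearMap.range (V * diagonal d * Vᴴ).mulVecLin = LinearMap.range V.mulVecLin := by
  apply le_antisymm
  · rintro _ ⟨v, rfl⟩
    exact ⟨diagonal d *ᵥ (Vᴴ *ᵥ v), by simp [mulVec_mulVec, Matrix.mul_assoc]⟩
  · rintro _ ⟨v, rfl⟩
    refine ⟨V *ᵥ (diagonal (fun i => (d i)⁻¹) *ᵥ v), ?_⟩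
    have h1 : V * diagonal d * Vᴴ * (V * diagonal fun i => (d i)⁻¹) = V := by
      rw [Matrix.mul_assoc, ← Matrix.mul_assoc Vᴴ, hV, Matrix.one_mul, Matrix.mul_assoc,
        diagonal_mul_diagonal]
      simp [hd]
    rw [mulVecLin_apply, mulVecLin_apply, mulVec_mulVec, mulVec_mulVec, Matrix.mul_assoc, h1]

/-- The polar decomposition of a matrix `Y` with `YᴴY = U D Uᴴ`. -/
lemma exists_isometry_of_conjTranspose_mul_self {m k : Type*} [Fintype m] [Fintype k]
    [DecidableEq m] [DecidableEq k] {Y : Matrix n m ℂ} {U : Matrix m k ℂ} (hU : Uᴴ * U = 1)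
    {d : k → ℝ} (hd : ∀ i, 0 < d i) (h : Yᴴ * Y = U * (diagonal fun i => (d i : ℂ)) * Uᴴ) :
    ∃ V : Matrix n k ℂ, Vᴴ * V = 1 ∧ Y = V * (diagonal fun i => ((√(d i) : ℝ) : ℂ)) * Uᴴ := by
  have hs : ∀ i, ((√(d i) : ℝ) : ℂ) ≠ 0 := fun i => by
    exact_mod_cast (Real.sqrt_pos.2 (hd i)).ne'
  have hss : ∀ i, (d i : ℂ) = ((√(d i) : ℝ) : ℂ) * ((√(d i) : ℝ) : ℂ) := fun i => by
    rw [← Complex.ofReal_mul, Real.mul_self_sqrt (hd i).le]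
  have hUY : Uᴴ * (Yᴴ * Y) * U = diagonal fun i => (d i : ℂ) := by
    rw [h]
    simp only [Matrix.mul_assoc, hU, Matrix.mul_one]
    rw [← Matrix.mul_assoc, hU, Matrix.one_mul]
  -- The inverse square root of the spectrum: the isometry is Y U D^(-1/2).
  set S : Matrix k k ℂ := diagonal fun i => ((√(d i) : ℝ) : ℂ)⁻¹ with hSdef
  have hS : Sᴴ = S := by
    rw [hSdef, diagonal_conjTranspose]
    congr 1
    ext i
    simp
  refine ⟨Y * U * S, ?_, ?_⟩
  · have h1 : (Y * U * S)ᴴ * (Y * U * S) = S * (Uᴴ * (Yᴴ * Y) * U) * S := by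
      rw [conjTranspose_mul, conjTranspose_mul, hS]
      simp only [Matrix.mul_assoc]
    rw [h1, hUY, hSdef, diagonal_mul_diagonal, diagonal_mul_diagonal, ← diagonal_one]
    congr 1
    ext i
    rw [hss i]
    field_simp [hs i]
  · have h2 : S * (diagonal fun i => ((√(d i) : ℝ) : ℂ)) = 1 := by
      rw [hSdef, diagonal_mul_diagonal, ← diagonal_one]
      congr 1
      ext i
      exact inv_mul_cancel₀ (hs i)
    -- What remains is Y = Y U Uᴴ, which holds because YᴴY, and hence Y, kills the complement of the
    -- range of `U`.
    rw [Matrix.mul_assoc _ S, h2, Matrix.mul_one, ← sub_eq_zero, ← conjTranspose_mul_self_eq_zero]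
    have h3 : Y - Y * U * Uᴴ = Y * (1 - U * Uᴴ) := by
      rw [Matrix.mul_sub, Matrix.mul_one, Matrix.mul_assoc]
    have h4 : Uᴴ * (1 - U * Uᴴ) = 0 := by
      rw [Matrix.mul_sub, Matrix.mul_one, ← Matrix.mul_assoc, hU, Matrix.one_mul, sub_self]
    rw [h3, conjTranspose_mul, Matrix.mul_assoc, ← Matrix.mul_assoc Yᴴ, h, Matrix.mul_assoc _ Uᴴ,
      h4, Matrix.mul_zero, Matrix.mul_zero]

lemma exists_hasForm {ρ : Matrix (A × B) (A × B) ℂ} (hρ : IsState ρ)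
    (h : entropy (traceA ρ) - entropy (traceB ρ) = entropy ρ) :
    ∃ (l r : ℕ) (V : Matrix B (Fin l × Fin r) ℂ) (ψ : A × Fin l → ℂ)
      (σ : Matrix (Fin r) (Fin r) ℂ), HasForm ρ V ψ σ ∧
        LinearMap.range V.mulVecLin = LinearMap.range (traceA ρ).mulVecLin := by
  obtain ⟨r, X₀, q, hX₀, hq, hρX⟩ := exists_thin_spectral hρ.1
  obtain ⟨l, U, c, hU, hc, hρA⟩ := exists_thin_spectral (isState_traceB hρ).1
  have hsq : ∀ k, ((√(q k) : ℝ) : ℂ) * ((√(q k) : ℝ) : ℂ) = q k := fun k => by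
    rw [← Complex.ofReal_mul, Real.mul_self_sqrt (hq k).le]
  have hsc : ∀ k, ((√(c k) : ℝ) : ℂ) * ((√(c k) : ℝ) : ℂ) = c k := fun k => by
    rw [← Complex.ofReal_mul, Real.mul_self_sqrt (hc k).le]
  -- Coefficients of a purification of ρ by R = `Fin r`; `Y` below is the same vector cut as B
  -- against AR.
  set X : Matrix (A × B) (Fin r) ℂ := X₀ * diagonal fun k => ((√(q k) : ℝ) : ℂ) with hX
  have hXc : Xᴴ = (diagonal fun k => ((√(q k) : ℝ) : ℂ)) * X₀ᴴ := by
    rw [hX, conjTranspose_mul, (isHermitian_diagonal_ofReal _).eq]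
  have hXX : X * Xᴴ = ρ := by
    rw [hρX, hXc, hX, Matrix.mul_assoc, ← Matrix.mul_assoc (diagonal _), diagonal_mul_diagonal,
      ← Matrix.mul_assoc]
    simp only [hsq]
  have hXX' : Xᴴ * X = diagonal fun k => (q k : ℂ) := by
    rw [hXc, hX, Matrix.mul_assoc, ← Matrix.mul_assoc X₀ᴴ, hX₀, Matrix.one_mul,
      diagonal_mul_diagonal]
    simp only [hsq]
  set Y : Matrix B (A × Fin r) ℂ := of fun b x => X (x.1, b) x.2 with hY
  have hYY : Y * Yᴴ = traceA ρ := by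
    rw [← hXX]
    ext b b'
    simp [hY, traceA, Matrix.mul_apply, Fintype.sum_prod_type]
  -- The reduced state on AR; the transpose corrects the index order of YᴴY.
  set τ : Matrix (A × Fin r) (A × Fin r) ℂ := (Yᴴ * Y)ᵀ with hτdef
  have hτB : traceB τ = traceB ρ := by
    rw [← hXX]
    ext a a'
    simp only [hτdef, hY, traceB, of_apply, Matrix.mul_apply, transpose_apply, conjTranspose_apply]
    rw [Finset.sum_comm]
    simp only [mul_comm]
  have hτA : traceA τ = diagonal fun k => (q k : ℂ) := by
    rw [← diagonal_transpose, ← hXX']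
    ext k k'
    simp only [hτdef, hY, traceA, of_apply, Matrix.mul_apply, transpose_apply, conjTranspose_apply,
      Fintype.sum_prod_type]
  have hτ : IsState τ := by
    refine ⟨(posSemidef_conjTranspose_mul_self Y).transpose, ?_⟩
    rw [← trace_traceB, hτB, (isState_traceB hρ).2]
  have hent : entropy τ = entropy (traceB τ) + entropy (traceA τ) := by
    rw [hτB, hτA, ← hXX', ← entropy_mul_conjTranspose, hXX, hτdef,
      entropy_transpose (isHermitian_conjTranspose_mul_self Y), ← entropy_mul_conjTranspose, hYY]
    linarith
  have hprod := eq_kronecker_of_entropy_eq hτ (isState_traceB hτ) (isState_traceA hτ) hent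
  rw [hτB, hτA, hρA] at hprod
  have hUt : (Uᴴᵀ)ᴴ = Uᵀ := by
    ext
    simp
  -- Because of that transpose, the eigenvectors of YᴴY use `Uᴴᵀ`, the entrywise conjugate of `U`.
  set T : Matrix (A × Fin r) (Fin l × Fin r) ℂ := Uᴴᵀ ⊗ₖ (1 : Matrix (Fin r) (Fin r) ℂ) with hT
  have hTc : Tᴴ = Uᵀ ⊗ₖ (1 : Matrix (Fin r) (Fin r) ℂ) := by
    rw [hT, conjTranspose_kronecker, hUt, conjTranspose_one]
  have hTT : Tᴴ * T = 1 := by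
    rw [hTc, hT, ← mul_kronecker_mul, ← transpose_mul, hU, transpose_one, Matrix.one_mul,
      one_kronecker_one]
  have hYT : Yᴴ * Y = T * (diagonal fun x : Fin l × Fin r => ((c x.1 * q x.2 : ℝ) : ℂ)) * Tᴴ := by
    have h1 : (diagonal fun x : Fin l × Fin r => ((c x.1 * q x.2 : ℝ) : ℂ))
        = (diagonal fun j => (c j : ℂ)) ⊗ₖ (diagonal fun k => (q k : ℂ)) := by
      rw [diagonal_kronecker_diagonal]
      push_cast
      rfl
    rw [← transpose_transpose (Yᴴ * Y), ← hτdef, hprod, h1, hTc, hT, ← mul_kronecker_mul,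
      ← mul_kronecker_mul, Matrix.one_mul, Matrix.mul_one, ← kroneckerMap_transpose,
      transpose_mul, transpose_mul, diagonal_transpose, diagonal_transpose, Matrix.mul_assoc]
  obtain ⟨V, hV, hYV⟩ := exists_isometry_of_conjTranspose_mul_self hTT
    (fun x : Fin l × Fin r => mul_pos (hc x.1) (hq x.2)) hYT
  -- The Schmidt form of a purification of ρ^A by B^L.
  set ψ : A × Fin l → ℂ := fun x => ((√(c x.2) : ℝ) : ℂ) * U x.1 x.2 with hψ
  set W := (1 : Matrix A A ℂ) ⊗ₖ V with hW
  -- The product purification: ψ times a purification of the state of R by B^R. `hXZ` says that `V`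
  -- carries it to `X`.
  set Z : Matrix (A × Fin l × Fin r) (Fin r) ℂ :=
    of fun x k => ψ (x.1, x.2.1) * diagonal (fun k => ((√(q k) : ℝ) : ℂ)) x.2.2 k with hZ
  have hXZ : X = W * Z := by
    ext ⟨a, b⟩ k
    have h1 : X (a, b) k = _ := congrFun (congrFun hYV b) (a, k)
    rw [h1, hTc, Matrix.mul_apply, Matrix.mul_apply]
    simp only [hW, hZ, hψ, mul_diagonal, kroneckerMap_apply, one_apply, of_apply, diagonal_apply,
      Fintype.sum_prod_type, transpose_apply, mul_ite, ite_mul, mul_one, one_mul, mul_zero,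
      zero_mul, Finset.sum_ite_irrel, Finset.sum_const_zero, Finset.sum_ite_eq,
      Finset.sum_ite_eq', Finset.mem_univ, if_true, Real.sqrt_mul (hc _).le, Complex.ofReal_mul]
    exact Finset.sum_congr rfl fun j _ => by ring
  have hZZ : Z * Zᴴ = tensor (proj ψ) (diagonal fun k => (q k : ℂ)) := by
    ext ⟨a, j, k⟩ ⟨a', j', k'⟩
    rw [Matrix.mul_apply, Finset.sum_eq_single k (fun x _ hx => by simp [hZ, hx.symm]) (by simp)]
    simp only [hZ, tensor, proj, conjTranspose_apply, of_apply, submatrix_apply, kroneckerMap_apply,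
      Equiv.prodAssoc_symm_apply, vecMulVec_apply, Pi.star_apply, star_mul']
    by_cases hk : k = k'
    · subst hk
      simp only [diagonal_apply_eq, ← hsq, RCLike.star_def, Complex.conj_ofReal]
      ring
    · simp [hk, Ne.symm hk]
  have hψA : traceB (proj ψ) = traceB ρ := by
    rw [hρA]
    ext a a'
    rw [Matrix.mul_apply]
    simp only [traceB, hψ, proj, of_apply, vecMulVec_apply, Pi.star_apply, mul_diagonal,
      conjTranspose_apply, star_mul', ← hsc, RCLike.star_def, Complex.conj_ofReal]
    exact Finset.sum_congr rfl fun j _ => by ring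
  refine ⟨l, r, V, ψ, diagonal fun k => (q k : ℂ), ⟨hV, ?_, ?_, ?_⟩, ?_⟩
  · refine isUnitVector_of_trace ?_
    rw [← trace_traceB, hψA, (isState_traceB hρ).2]
  · rw [← hτA]
    exact isState_traceA hτ
  · change ρ = W * tensor (proj ψ) (diagonal fun k => (q k : ℂ)) * Wᴴ
    rw [← hXX, hXZ, conjTranspose_mul, ← hZZ]
    simp only [Matrix.mul_assoc]
  -- Only positive eigenvalues were kept, so the diagonal factor is invertible and `V` has exactly
  -- the range of ρ^B.
  · have h1 : traceA ρ = V * (diagonal fun x : Fin l × Fin r => ((c x.1 * q x.2 : ℝ) : ℂ)) * Vᴴ := by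
      rw [← hYY, hYV, conjTranspose_mul, conjTranspose_mul, conjTranspose_conjTranspose,
        (isHermitian_diagonal_ofReal _).eq, Matrix.mul_assoc, ← Matrix.mul_assoc Tᴴ, hTT,
        Matrix.one_mul, Matrix.mul_assoc, ← Matrix.mul_assoc (diagonal _), diagonal_mul_diagonal,
        ← Matrix.mul_assoc]
      simp only [← Complex.ofReal_mul, Real.mul_self_sqrt (mul_pos (hc _) (hq _)).le]
    rw [h1]
    exact (range_mul_diagonal_mul_conjTranspose hV fun x => by
      exact_mod_cast (mul_pos (hc x.1) (hq x.2)).ne').symm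

end Structure

end QDiscord

/-! ### Assembly of the theorem. -/

theorem theorem2 {A B : Type*} [Fintype A] [Fintype B] [DecidableEq A] [DecidableEq B]
    (ρ : Matrix (A × B) (A × B) ℂ) (hρ : QDiscord.IsState ρ) :
    -- the equality condition gives `D(A|B) = S(A)`
    (QDiscord.entropy (QDiscord.traceA ρ) - QDiscord.entropy (QDiscord.traceB ρ)
        = QDiscord.entropy ρ →
      QDiscord.discord ρ = QDiscord.entropy (QDiscord.traceB ρ)) ∧
    -- it holds exactly for the states `|ψ⟩⟨ψ| ⊗ σ`, with `B^L ⊗ B^R` the support of `ρ^B`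
    (QDiscord.entropy (QDiscord.traceA ρ) - QDiscord.entropy (QDiscord.traceB ρ)
        = QDiscord.entropy ρ ↔
      ∃ (l r : ℕ) (V : Matrix B (Fin l × Fin r) ℂ) (ψ : A × Fin l → ℂ)
        (σ : Matrix (Fin r) (Fin r) ℂ), QDiscord.HasForm ρ V ψ σ ∧
          LinearMap.range V.mulVecLin = LinearMap.range (QDiscord.traceA ρ).mulVecLin) ∧
    -- for every state of this form (with `B^L ⊗ B^R` any subspace of `B`), the equality condition
    -- holds, the optima that define the quantities are attained, and all the quantities are equal
    (∀ (l r : ℕ) (V : Matrix B (Fin l × Fin r) ℂ) (ψ : A × Fin l → ℂ)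
        (σ : Matrix (Fin r) (Fin r) ℂ), QDiscord.HasForm ρ V ψ σ →
      QDiscord.entropy (QDiscord.traceA ρ) - QDiscord.entropy (QDiscord.traceB ρ)
        = QDiscord.entropy ρ ∧
      IsGreatest (QDiscord.measGains ρ) (QDiscord.classicalCorr ρ) ∧
      IsGreatest (QDiscord.measGains (QDiscord.swap ρ))
        (QDiscord.classicalCorr (QDiscord.swap ρ)) ∧
      IsLeast (QDiscord.avgEntanglements ρ) (QDiscord.entFormation ρ) ∧
      QDiscord.discord ρ = QDiscord.entropy (QDiscord.traceB ρ) ∧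
      QDiscord.discord (QDiscord.swap ρ) = QDiscord.entropy (QDiscord.traceB ρ) ∧
      QDiscord.entFormation ρ = QDiscord.entropy (QDiscord.traceB ρ) ∧
      QDiscord.entropy (QDiscord.traceA (QDiscord.proj ψ))
        = QDiscord.entropy (QDiscord.traceB ρ)) := by
  refine ⟨fun h => ?_, ⟨fun h => QDiscord.exists_hasForm hρ h, ?_⟩, ?_⟩
  · obtain ⟨l, r, V, ψ, σ, hf, -⟩ := QDiscord.exists_hasForm hρ h
    exact hf.discord_eq hρ
  · rintro ⟨l, r, V, ψ, σ, hf, -⟩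
    exact hf.entropy_sub
  · intro l r V ψ σ hf
    have hJ := hf.isGreatest hρ
    have hJ' := hf.isGreatest_swap
    have hE := hf.avgEntanglements_eq hρ
    have hF : QDiscord.entFormation ρ = QDiscord.entropy (QDiscord.traceB ρ) := by
      rw [QDiscord.entFormation, hE, csInf_singleton]
    refine ⟨hf.entropy_sub, ?_, ?_, ?_, hf.discord_eq hρ, hf.discord_swap_eq hρ, hF, ?_⟩
    · rwa [QDiscord.classicalCorr, hJ.csSup_eq]
    · rwa [QDiscord.classicalCorr, hJ'.csSup_eq]
    · rw [hF, hE]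
      exact isLeast_singleton
    · rw [QDiscord.entropy_traceA_proj, hf.traceB_eq]
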